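/- Let $\mathbb D=\{z\in\mathbb C:|z|<1\}$. A semigroup of holomorphic self-maps of $\mathbb D$ is a family $(\phi_t)_{t\ge 0}$ of holomorphic maps $\phi_t:\mathbb D\to\mathbb D$ with $\phi_0=\mathrm{id}$ and $\phi_{s+t}=\phi_s\circ\phi_t$ for all $s,t\ge 0$, such that $t\mapsto\phi_t$ is continuous with respect to uniform convergence on compact subsets of $\mathbb D$. A holomorphic function $G:\mathbb D\to\mathbb C$ is an infinitesimal generator if there is such a semigroup $(\phi_t)$ with $$\frac{\partial \phi_t(z)}{\partial t}=G(\phi_t(z))\qquad\text{for all } z\in\mathbb D,\ t\ge 0.$$ For $R>1$ and $x\in\partial\mathbb D$ let $K(x,R)=\{z\in\mathbb D:|x-z|<R(1-|z|)\}$, and for $f:\mathbb D\to[0,+\infty)$ define the non-tangential lower limit $$\angle\liminf_{z\to x}f(z):=\inf_{R>1}\ \liminf_{K(x,R)\ni z\to x}f(z)\in[0,+\infty].$$ For $D\in(0,+\infty)$, a point $x\in\partial\mathbb D$ is a regular pole of $G$ of mass $D$ if $$\angle\liminf_{z\to x}|G(z)(x-z)|=D,$$ and $\mathcal P_D(G)$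 denotes the set of regular poles of $G$ of mass $D$. Corollary. Let $G$ be an infinitesimal generator in $\mathbb D$. Then for every real $C>0$ the set $$\bigcup_{D\ge C}\mathcal P_D(G)$$ (the union over real $D\ge C$) is finite. -/

import Mathlib

open Set Filter Topology
open scoped ENNReal

/-- A (one-parameter, continuous) semigroup `(φ t)`, `t ≥ 0`, of holomorphic self-maps of the
open unit disc: `φ` is a homomorphism from `([0, ∞), +)` to the holomorphic self-maps of the disc
under composition, continuous for uniform convergence on compact subsets of the disc.
Only the values `φ t z` with `t ≥ 0` and `‖z‖ < 1` are relevant. -/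
structure IsHolSemigroup (φ : ℝ → ℂ → ℂ) : Prop where
  mapsTo : ∀ t, 0 ≤ t → MapsTo (φ t) (Metric.ball (0 : ℂ) 1) (Metric.ball (0 : ℂ) 1)
  holomorphic : ∀ t, 0 ≤ t → DifferentiableOn ℂ (φ t) (Metric.ball (0 : ℂ) 1)
  map_zero : ∀ z ∈ Metric.ball (0 : ℂ) 1, φ 0 z = z
  map_add : ∀ s t, 0 ≤ s → 0 ≤ t → ∀ z ∈ Metric.ball (0 : ℂ) 1, φ (s + t) z = φ s (φ t z)
  continuous : ∀ t, 0 ≤ t → ∀ K : Set ℂ, K ⊆ Metric.ball (0 : ℂ) 1 → IsCompact K →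
    TendstoUniformlyOn φ (φ t) (𝓝[Ici 0] t) K

/-- `G` is the infinitesimal generator of the semigroup `(φ t)`: it is holomorphic in the disc and
`∂ φ t z / ∂ t = G (φ t z)` for all `t ≥ 0` (a one-sided derivative at `t = 0`) and all `z` in
the disc. -/
def IsGeneratorOf (G : ℂ → ℂ) (φ : ℝ → ℂ → ℂ) : Prop :=
  DifferentiableOn ℂ G (Metric.ball (0 : ℂ) 1) ∧
    ∀ z ∈ Metric.ball (0 : ℂ) 1, ∀ t, 0 ≤ t →
      HasDerivWithinAt (fun s : ℝ => φ s z) (G (φ t z)) (Ici 0) t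

/-- `G` is an infinitesimal generator in the unit disc. -/
def IsInfinitesimalGenerator (G : ℂ → ℂ) : Prop :=
  ∃ φ : ℝ → ℂ → ℂ, IsHolSemigroup φ ∧ IsGeneratorOf G φ

/-- The Stolz region of vertex `x` (a point of the unit circle) and amplitude `R > 1`. -/
def stolzRegion (x : ℂ) (R : ℝ) : Set ℂ :=
  {z | z ∈ Metric.ball (0 : ℂ) 1 ∧ ‖x - z‖ < R * (1 - ‖z‖)}

/-- The non-tangential (angular) lower limit of `f` at the point `x` of the unit circle: the
infimum over all Stolz regions at `x` of the lower limit of `f` at `x` within the region,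
that is, the smallest limit of `f` along sequences converging non-tangentially to `x`. -/
noncomputable def angularLiminf (f : ℂ → ℝ≥0∞) (x : ℂ) : ℝ≥0∞ :=
  ⨅ R ∈ Ioi (1 : ℝ), liminf f (𝓝[stolzRegion x R] x)

/-- The set of regular poles of `G` of mass `C` (meaningful for `0 < C`). -/
def regularPolesOfMass (G : ℂ → ℂ) (C : ℝ) : Set ℂ :=
  {x | x ∈ Metric.sphere (0 : ℂ) 1 ∧
    angularLiminf (fun z => ‖G z * (x - z)‖ₑ) x = ENNReal.ofReal C}

/-! Differentiating the Schwarz–Pick inequality for `φ t` between `z` and `0` at `t = 0` gives `G z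
= G 0 - conj (G 0) * z ^ 2 - z * p z` with `Re p ≥ 0` on the disc
(`IsInfinitesimalGenerator.re_conj_mul_le`). At a pole of mass at least `C`, `p` inherits from `G`
radial growth of order at least `C / (1 - r)`. By Schwarz–Pick in the half-plane, such growth at `x`
forces `Re p` to dominate `C / 2` times the Poisson kernel at `x`
(`poisson_le_re_of_radial_growth`). Subtracting these kernels one pole at a time keeps the real part
non-negative, so evaluation at `0` shows that `n` poles satisfy `n * (C / 2) ≤ Re (p 0)`. -/

/-! ### Schwarz–Pick inequalities in the disc and half-plane -/

theorem norm_sq_one_sub_conj_mul (z w : ℂ) :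
    ‖1 - (starRingEnd ℂ) w * z‖ ^ 2 - ‖z - w‖ ^ 2 = (1 - ‖z‖ ^ 2) * (1 - ‖w‖ ^ 2) := by
  simp only [← Complex.normSq_eq_norm_sq, Complex.normSq_apply]
  simp
  ring

theorem one_sub_conj_mul_ne_zero {z w : ℂ} (hz : ‖z‖ < 1) (hw : ‖w‖ < 1) :
    1 - (starRingEnd ℂ) w * z ≠ 0 := by
  intro h
  have h2 : ‖(starRingEnd ℂ) w * z‖ = 1 := by rw [← sub_eq_zero.1 h, norm_one]
  rw [norm_mul, RCLike.norm_conj] at h2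
  nlinarith [norm_nonneg z, norm_nonneg w]

/-- The Schwarz lemma for a function vanishing at an arbitrary point `w` of the disc. -/
theorem norm_mul_le_of_mapsTo_of_eq_zero {f : ℂ → ℂ}
    (hd : DifferentiableOn ℂ f (Metric.ball 0 1))
    (hm : MapsTo f (Metric.ball 0 1) (Metric.closedBall 0 1)) {z w : ℂ}
    (hz : ‖z‖ < 1) (hw : ‖w‖ < 1) (h0 : f w = 0) :
    ‖f z‖ * ‖1 - (starRingEnd ℂ) w * z‖ ≤ ‖z - w‖ := by
  -- The disc automorphism taking `0` to `w`; the Schwarz lemma is applied to `f ∘ ψ` at the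
  -- preimage of `z`.
  set ψ : ℂ → ℂ := fun u => (u + w) / (1 + (starRingEnd ℂ) w * u) with hψ
  have hne : ∀ u : ℂ, ‖u‖ < 1 → 1 + (starRingEnd ℂ) w * u ≠ 0 := by
    intro u hu
    have := one_sub_conj_mul_ne_zero (z := -u) (by simpa using hu) hw
    simpa using this
  have hψm : MapsTo ψ (Metric.ball 0 1) (Metric.ball 0 1) := by
    intro u hu
    rw [mem_ball_zero_iff] at hu ⊢
    have h1 := norm_sq_one_sub_conj_mul (-u) w
    have h2 : 0 < (1 - ‖-u‖ ^ 2) * (1 - ‖w‖ ^ 2) := by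
      rw [norm_neg]
      apply mul_pos <;> nlinarith [norm_nonneg u, norm_nonneg w]
    have h3 : ‖-u - w‖ = ‖u + w‖ := by rw [← norm_neg]; congr 1; ring
    have h4 : 1 - (starRingEnd ℂ) w * -u = 1 + (starRingEnd ℂ) w * u := by ring
    rw [h3, h4] at h1
    rw [hψ]
    simp only [norm_div]
    rw [div_lt_one (norm_pos_iff.2 (hne u hu))]
    exact lt_of_pow_lt_pow_left₀ 2 (norm_nonneg _) (by linarith)
  have hψd : DifferentiableOn ℂ ψ (Metric.ball 0 1) := by
    intro u hu
    have := hne u (by simpa using hu)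
    exact DifferentiableAt.differentiableWithinAt (by fun_prop (disch := assumption))
  have hden := one_sub_conj_mul_ne_zero hz hw
  set u : ℂ := (z - w) / (1 - (starRingEnd ℂ) w * z) with hu
  have hu1 : ‖u‖ < 1 := by
    have h1 := norm_sq_one_sub_conj_mul z w
    have h2 : 0 < (1 - ‖z‖ ^ 2) * (1 - ‖w‖ ^ 2) := by
      apply mul_pos <;> nlinarith [norm_nonneg z, norm_nonneg w]
    rw [hu, norm_div, div_lt_one (norm_pos_iff.2 hden)]
    exact lt_of_pow_lt_pow_left₀ 2 (norm_nonneg _) (by linarith)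
  have hψu : ψ u = z := by
    have h5 := hne u hu1
    simp only [hψ]
    have h6 : u * (1 - (starRingEnd ℂ) w * z) = z - w := div_mul_cancel₀ _ hden
    rw [div_eq_iff h5]
    linear_combination h6
  have := Complex.norm_le_norm_of_mapsTo_ball (f := f ∘ ψ) (R := 1) (z := u)
    (hd.comp hψd hψm) (hm.comp hψm) (by simp [hψ, h0]) hu1
  rw [Function.comp, hψu, hu, norm_div, le_div_iff₀ (norm_pos_iff.2 hden)] at this
  exact this

/-- The Schwarz–Pick inequality for holomorphic self-maps of the disc. -/
theorem schwarzPick_ball {f : ℂ → ℂ} (hd : DifferentiableOn ℂ f (Metric.ball 0 1))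
    (hm : MapsTo f (Metric.ball 0 1) (Metric.ball 0 1)) {z w : ℂ}
    (hz : ‖z‖ < 1) (hw : ‖w‖ < 1) :
    ‖f z - f w‖ * ‖1 - (starRingEnd ℂ) w * z‖ ≤
      ‖z - w‖ * ‖1 - (starRingEnd ℂ) (f w) * f z‖ := by
  have hf : ∀ u : ℂ, ‖u‖ < 1 → ‖f u‖ < 1 := fun u hu => by
    simpa using hm (mem_ball_zero_iff.2 hu)
  have hne : ∀ u : ℂ, ‖u‖ < 1 → 1 - (starRingEnd ℂ) (f w) * f u ≠ 0 := fun u hu =>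
    one_sub_conj_mul_ne_zero (hf u hu) (hf w hw)
  have := norm_mul_le_of_mapsTo_of_eq_zero
    (f := fun u => (f u - f w) / (1 - (starRingEnd ℂ) (f w) * f u)) (z := z) (w := w)
    ((hd.sub_const _).div ((hd.const_mul _).const_sub _)
      (fun u hu => hne u (by simpa using hu))) ?_ hz hw (by simp)
  · rw [norm_div, div_mul_eq_mul_div, div_le_iff₀ (norm_pos_iff.2 (hne z hz))] at this
    exact this
  · intro u hu
    rw [mem_ball_zero_iff] at hu
    have h1 := norm_sq_one_sub_conj_mul (f u) (f w)
    have h2 : 0 ≤ (1 - ‖f u‖ ^ 2) * (1 - ‖f w‖ ^ 2) := by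
      have := hf u hu
      have := hf w hw
      apply mul_nonneg <;> nlinarith [norm_nonneg (f u), norm_nonneg (f w)]
    rw [mem_closedBall_zero_iff, norm_div, div_le_one (norm_pos_iff.2 (hne u hu))]
    exact le_of_sq_le_sq (by linarith) (norm_nonneg _)

theorem norm_sq_add_conj (a b : ℂ) :
    ‖a + (starRingEnd ℂ) b‖ ^ 2 - ‖a - b‖ ^ 2 = 4 * a.re * b.re := by
  simp only [← Complex.normSq_eq_norm_sq, Complex.normSq_apply]
  simp
  ring

/-- The Cayley-type map `ζ ↦ (ζ - p w) / (ζ + conj (p w))` takes the right half-plane to the disc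
and `p w` to `0`, reducing this to the Schwarz lemma. -/
theorem schwarzPick_halfPlane_of_pos {p : ℂ → ℂ} (hd : DifferentiableOn ℂ p (Metric.ball 0 1))
    (hp : ∀ z : ℂ, ‖z‖ < 1 → 0 < (p z).re) {z w : ℂ} (hz : ‖z‖ < 1) (hw : ‖w‖ < 1) :
    ‖p z + (starRingEnd ℂ) (p w)‖ ^ 2 * ((1 - ‖z‖ ^ 2) * (1 - ‖w‖ ^ 2)) ≤
      4 * (p z).re * (p w).re * ‖1 - (starRingEnd ℂ) w * z‖ ^ 2 := by
  have hne : ∀ u : ℂ, ‖u‖ < 1 → p u + (starRingEnd ℂ) (p w) ≠ 0 := by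
    intro u hu h
    have h1 := congrArg Complex.re h
    simp only [Complex.add_re, Complex.conj_re, Complex.zero_re] at h1
    linarith [hp u hu, hp w hw]
  have := norm_mul_le_of_mapsTo_of_eq_zero
    (f := fun u => (p u - p w) / (p u + (starRingEnd ℂ) (p w))) (z := z) (w := w)
    ((hd.sub_const _).div (hd.add_const _) (fun u hu => hne u (by simpa using hu))) ?_ hz hw
    (by simp)
  · rw [norm_div, div_mul_eq_mul_div, div_le_iff₀ (norm_pos_iff.2 (hne z hz))] at this
    have h2 := pow_le_pow_left₀ (by positivity) this 2
    rw [mul_pow, mul_pow] at h2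
    rw [← norm_sq_one_sub_conj_mul, ← norm_sq_add_conj]
    linarith
  · intro u hu
    rw [mem_ball_zero_iff] at hu
    have h1 := norm_sq_add_conj (p u) (p w)
    have h2 : 0 < (p u).re * (p w).re := mul_pos (hp u hu) (hp w hw)
    rw [mem_closedBall_zero_iff, norm_div, div_le_one (norm_pos_iff.2 (hne u hu))]
    exact le_of_sq_le_sq (by linarith) (norm_nonneg _)

/-- The Schwarz–Pick inequality for holomorphic maps of the disc to the closed right half-plane. -/
theorem schwarzPick_halfPlane {p : ℂ → ℂ} (hd : DifferentiableOn ℂ p (Metric.ball 0 1))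
    (hp : ∀ z : ℂ, ‖z‖ < 1 → 0 ≤ (p z).re) {z w : ℂ} (hz : ‖z‖ < 1) (hw : ‖w‖ < 1) :
    ‖p z + (starRingEnd ℂ) (p w)‖ ^ 2 * ((1 - ‖z‖ ^ 2) * (1 - ‖w‖ ^ 2)) ≤
      4 * (p z).re * (p w).re * ‖1 - (starRingEnd ℂ) w * z‖ ^ 2 := by
  have key : ∀ ε : ℝ, 0 < ε →
      ‖(p z + ε) + (starRingEnd ℂ) (p w + ε)‖ ^ 2 * ((1 - ‖z‖ ^ 2) * (1 - ‖w‖ ^ 2)) ≤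
        4 * (p z + ε).re * (p w + ε).re * ‖1 - (starRingEnd ℂ) w * z‖ ^ 2 := by
    intro ε hε
    refine schwarzPick_halfPlane_of_pos (p := fun u => p u + ε) (hd.add_const _) ?_ hz hw
    intro u hu
    simpa using add_pos_of_nonneg_of_pos (hp u hu) hε
  have h1 : Continuous fun ε : ℝ =>
      ‖(p z + ε) + (starRingEnd ℂ) (p w + ε)‖ ^ 2 * ((1 - ‖z‖ ^ 2) * (1 - ‖w‖ ^ 2)) := by
    fun_prop
  have h2 : Continuous fun ε : ℝ =>
      4 * (p z + ε).re * (p w + ε).re * ‖1 - (starRingEnd ℂ) w * z‖ ^ 2 := by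
    fun_prop
  have := le_of_tendsto_of_tendsto (h1.tendsto 0 |>.mono_left nhdsWithin_le_nhds)
    (h2.tendsto 0 |>.mono_left nhdsWithin_le_nhds)
    (eventually_nhdsWithin_of_forall (s := Ioi 0) fun ε hε => key ε hε)
  simpa using this

/-! ### Radial growth and Poisson kernels -/

/-- Radial growth of order `C / (1 - r)` of a holomorphic function with non-negative real part
forces a Poisson-kernel minorant. -/
theorem poisson_le_re_of_radial_growth {p : ℂ → ℂ}
    (hd : DifferentiableOn ℂ p (Metric.ball 0 1)) (hp : ∀ z : ℂ, ‖z‖ < 1 → 0 ≤ (p z).re)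
    {x : ℂ} (hx : ‖x‖ = 1) {C : ℝ} (hC : 0 < C)
    (hg : ∀ c < C, ∀ᶠ r : ℝ in 𝓝[<] 1, c < (1 - r) * ‖p (r * x)‖) {z : ℂ} (hz : ‖z‖ < 1) :
    C / 2 * (1 - ‖z‖ ^ 2) ≤ (p z).re * ‖x - z‖ ^ 2 := by
  have hxz : ‖1 - (starRingEnd ℂ) x * z‖ = ‖x - z‖ := by
    have h1 := norm_sq_one_sub_conj_mul z x
    rw [hx, norm_sub_rev z x] at h1
    have h2 : ‖1 - (starRingEnd ℂ) x * z‖ ^ 2 = ‖x - z‖ ^ 2 := by linarith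
    exact (sq_eq_sq₀ (norm_nonneg _) (norm_nonneg _)).1 h2
  have hz2 : 0 < 1 - ‖z‖ ^ 2 := by nlinarith [norm_nonneg z]
  have key : ∀ c, 0 < c → c < C →
      c / 2 * (1 - ‖z‖ ^ 2) ≤ (p z).re * ‖x - z‖ ^ 2 := by
    intro c hc0 hcC
    -- Schwarz–Pick between `z` and `r * x`: one factor `‖p (r * x)‖` cancels against `Re p (r *
    -- x)`, the other supplies the growth. As `r → 1` the factor `1 + r` tends to `2`, hence `c /
    -- 2`.
    have hev : ∀ᶠ r : ℝ in 𝓝[<] 1,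
        (c - 2 * ‖p z‖ * (1 - r)) * (1 + r) * (1 - ‖z‖ ^ 2) ≤
          4 * (p z).re * ‖1 - (starRingEnd ℂ) (r * x) * z‖ ^ 2 := by
      filter_upwards [hg c hcC, Ioo_mem_nhdsLT (show (0 : ℝ) < 1 by norm_num)] with r hr hr1
      have hrx : ‖(r : ℂ) * x‖ = r := by
        rw [norm_mul, hx, mul_one, Complex.norm_real, Real.norm_of_nonneg hr1.1.le]
      have h1 := schwarzPick_halfPlane hd hp hz (w := r * x) (by rw [hrx]; exact hr1.2)
      rw [hrx] at h1
      set m := ‖p (r * x)‖ with hm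
      have hr2 : 0 < 1 - r := by linarith [hr1.2]
      have hm0 : 0 < m := by
        by_contra hcon
        nlinarith
      have h2 : (m - ‖p z‖) ^ 2 ≤ ‖p z + (starRingEnd ℂ) (p (r * x))‖ ^ 2 := by
        rw [sq_le_sq, abs_norm, abs_sub_comm]
        have := abs_norm_sub_norm_le (p z) (-(starRingEnd ℂ) (p (r * x)))
        rwa [norm_neg, RCLike.norm_conj, sub_neg_eq_add] at this
      have h3 : m * (m - 2 * ‖p z‖) ≤ ‖p z + (starRingEnd ℂ) (p (r * x))‖ ^ 2 := by
        nlinarith [sq_nonneg ‖p z‖]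
      have hpos : 0 < (1 - ‖z‖ ^ 2) * (1 - r ^ 2) := mul_pos hz2 (by nlinarith [hr1.1])
      have h4 : (p (r * x)).re ≤ m := Complex.re_le_norm _
      have h5 := hp z hz
      have h6 : m * ((m - 2 * ‖p z‖) * ((1 - ‖z‖ ^ 2) * (1 - r ^ 2))) ≤
          m * (4 * (p z).re * ‖1 - (starRingEnd ℂ) (r * x) * z‖ ^ 2) := by
        calc _ = m * (m - 2 * ‖p z‖) * ((1 - ‖z‖ ^ 2) * (1 - r ^ 2)) := by ring
          _ ≤ _ := mul_le_mul_of_nonneg_right h3 hpos.le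
          _ ≤ _ := h1
          _ = (p (r * x)).re * (4 * (p z).re * ‖1 - (starRingEnd ℂ) (r * x) * z‖ ^ 2) := by ring
          _ ≤ _ := mul_le_mul_of_nonneg_right h4 (by positivity)
      have h7 := le_of_mul_le_mul_left h6 hm0
      refine le_trans ?_ h7
      have h8 : (c - 2 * ‖p z‖ * (1 - r)) ≤ (m - 2 * ‖p z‖) * (1 - r) := by nlinarith
      calc _ ≤ (m - 2 * ‖p z‖) * (1 - r) * (1 + r) * (1 - ‖z‖ ^ 2) := by
            refine mul_le_mul_of_nonneg_right (mul_le_mul_of_nonneg_right h8 ?_) hz2.le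
            linarith [hr1.1]
        _ = _ := by ring
    have c1 : Continuous fun r : ℝ => (c - 2 * ‖p z‖ * (1 - r)) * (1 + r) * (1 - ‖z‖ ^ 2) := by
      fun_prop
    have c2 : Continuous fun r : ℝ => 4 * (p z).re * ‖1 - (starRingEnd ℂ) (r * x) * z‖ ^ 2 := by
      fun_prop
    have := le_of_tendsto_of_tendsto (c1.tendsto 1 |>.mono_left nhdsWithin_le_nhds)
      (c2.tendsto 1 |>.mono_left nhdsWithin_le_nhds) hev
    simp only [Complex.ofReal_one, one_mul, hxz] at this
    linarith
  have c1 : Continuous fun c : ℝ => c / 2 * (1 - ‖z‖ ^ 2) := by fun_prop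
  refine le_of_tendsto (c1.tendsto C |>.mono_left (nhdsWithin_le_nhds (s := Iio C))) ?_
  filter_upwards [Ioo_mem_nhdsLT hC] with c hc using key c hc.1 hc.2

/-- Lower growth bounds survive a vanishing error. -/
theorem eventually_lt_of_le_add {l : Filter ℝ} {u v e : ℝ → ℝ} {C : ℝ}
    (hu : ∀ c < C, ∀ᶠ r in l, c < u r) (he : Tendsto e l (𝓝 0))
    (huv : ∀ᶠ r in l, u r ≤ v r + e r) : ∀ c < C, ∀ᶠ r in l, c < v r := by
  intro c hc
  have h1 : 0 < (C - c) / 2 := by linarith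
  filter_upwards [hu ((c + C) / 2) (by linarith), he.eventually_lt_const h1, huv] with r h2 h3 h4
  linarith

theorem sub_ne_zero_of_norm_lt_one {x z : ℂ} (hx : ‖x‖ = 1) (hz : ‖z‖ < 1) : x - z ≠ 0 := by
  intro h
  rw [sub_eq_zero] at h
  rw [← h, hx] at hz
  exact lt_irrefl _ hz

theorem re_add_div_sub {x z : ℂ} (hx : ‖x‖ = 1) :
    ((x + z) / (x - z)).re = (1 - ‖z‖ ^ 2) / ‖x - z‖ ^ 2 := by
  rw [Complex.div_re, ← add_div, ← Complex.normSq_eq_norm_sq (x - z)]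
  congr 1
  have : ‖x‖ ^ 2 = 1 := by rw [hx]; norm_num
  rw [← this]
  simp only [← Complex.normSq_eq_norm_sq, Complex.normSq_apply]
  simp
  ring

/-- A holomorphic function with non-negative real part on the disc has boundedly many boundary
points of radial growth at least `C / (1 - r)`. -/
theorem card_mul_le_re_of_radial_growth {C : ℝ} (hC : 0 < C) (S : Finset ℂ) :
    ∀ p : ℂ → ℂ, DifferentiableOn ℂ p (Metric.ball 0 1) → (∀ z : ℂ, ‖z‖ < 1 → 0 ≤ (p z).re) →
      (∀ x ∈ S, ‖x‖ = 1 ∧ ∀ c < C, ∀ᶠ r : ℝ in 𝓝[<] 1, c < (1 - r) * ‖p (r * x)‖) →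
      S.card * (C / 2) ≤ (p 0).re := by
  induction S using Finset.induction_on with
  | empty =>
    intro p _ hp _
    simpa using hp 0 (by simp)
  | insert x S hxS ih =>
    intro p hd hp hS
    obtain ⟨hx, hg⟩ := hS x (Finset.mem_insert_self _ _)
    have := ih (fun z => p z - (C / 2 : ℝ) * ((x + z) / (x - z))) ?_ ?_ ?_
    · have hx0 : x ≠ 0 := by rintro rfl; simp at hx
      have h2 : ((x + 0) / (x - 0) : ℂ) = 1 := by simp [hx0]
      rw [h2, mul_one, Complex.sub_re, Complex.ofReal_re] at this
      rw [Finset.card_insert_of_notMem hxS]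
      push_cast
      linarith
    · refine hd.sub ?_
      intro u hu
      have := sub_ne_zero_of_norm_lt_one hx (by simpa using hu : ‖u‖ < 1)
      exact DifferentiableAt.differentiableWithinAt (by fun_prop (disch := assumption))
    · intro z hz
      have h1 := poisson_le_re_of_radial_growth hd hp hx hC hg hz
      have h2 := norm_pos_iff.2 (sub_ne_zero_of_norm_lt_one hx hz)
      rw [Complex.sub_re, Complex.re_ofReal_mul, re_add_div_sub hx, sub_nonneg, ← mul_div_assoc,
        div_le_iff₀ (by positivity)]
      exact h1
    · intro y hy
      obtain ⟨hy1, hgy⟩ := hS y (Finset.mem_insert_of_mem hy)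
      have hxy : x ≠ y := by rintro rfl; exact hxS hy
      refine ⟨hy1, eventually_lt_of_le_add hgy
        (e := fun r : ℝ => (1 - r) * ‖((C / 2 : ℝ) : ℂ) * ((x + r * y) / (x - r * y))‖) ?_ ?_⟩
      -- The kernel with pole `x` stays bounded near `y ≠ x`, so the factor `1 - r` kills it.
      · have hne : x - ((1 : ℝ) : ℂ) * y ≠ 0 := by simpa using sub_ne_zero.2 hxy
        have : ContinuousAt
            (fun r : ℝ => (1 - r) * ‖((C / 2 : ℝ) : ℂ) * ((x + r * y) / (x - r * y))‖) 1 := by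
          fun_prop (disch := assumption)
        have h3 := this.tendsto.mono_left (nhdsWithin_le_nhds (s := Iio 1))
        simpa using h3
      · filter_upwards [self_mem_nhdsWithin] with r hr
        rw [← mul_add]
        refine mul_le_mul_of_nonneg_left ?_ (sub_nonneg.2 (le_of_lt hr))
        rw [← sub_le_iff_le_add]
        exact norm_sub_norm_le _ _

/-! ### Generators and their regular poles -/

/-- The infinitesimal form of the Schwarz–Pick inequality for an infinitesimal generator. -/
theorem IsInfinitesimalGenerator.re_conj_mul_le {G : ℂ → ℂ} (hG : IsInfinitesimalGenerator G)
    {z : ℂ} (hz : ‖z‖ < 1) :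
    ((starRingEnd ℂ) z * (G z - G 0 + (starRingEnd ℂ) (G 0) * z ^ 2)).re ≤ 0 := by
  obtain ⟨φ, hφ, -, hder⟩ := hG
  have h0 : ‖(0 : ℂ)‖ < 1 := by simp
  have hz' : z ∈ Metric.ball (0 : ℂ) 1 := by simpa using hz
  have h0' : (0 : ℂ) ∈ Metric.ball (0 : ℂ) 1 := by simp
  have dz := hder z hz' 0 le_rfl
  have d0 := hder 0 h0' 0 le_rfl
  have ez := hφ.map_zero z hz'
  have e0 := hφ.map_zero 0 h0'
  rw [ez] at dz
  rw [e0] at d0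
  have dN := (dz.sub d0).norm_sq
  have dD := ((d0.star.mul dz).const_sub 1).norm_sq
  have dF := dN.sub (dD.const_mul (‖z‖ ^ 2))
  -- Schwarz–Pick makes this non-positive for `t ≥ 0`, with equality at `t = 0`, so its one-sided
  -- derivative there is at most `0`.
  have hmax : IsLocalMaxOn (fun t => ‖φ t z - φ t 0‖ ^ 2 -
      ‖z‖ ^ 2 * ‖1 - (starRingEnd ℂ) (φ t 0) * φ t z‖ ^ 2) (Ici 0) (0 : ℝ) := by
    filter_upwards [self_mem_nhdsWithin] with t ht
    have h1 := schwarzPick_ball (hφ.holomorphic t ht) (hφ.mapsTo t ht) hz h0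
    simp only [map_zero, zero_mul, sub_zero, norm_one, mul_one] at h1
    have h2 := pow_le_pow_left₀ (norm_nonneg _) h1 2
    rw [mul_pow] at h2
    simp only [ez, e0]
    simp
    linarith
  have h3 := hmax.hasFDerivWithinAt_nonpos dF.hasFDerivWithinAt (y := 1) (by
    apply mem_posTangentConeAt_of_segment_subset
    rw [zero_add, segment_eq_Icc zero_le_one]
    exact Icc_subset_Ici_self)
  simp [ez, e0, Complex.inner] at h3
  have hsq : ‖z‖ ^ 2 = z.re * z.re + z.im * z.im := by
    rw [← Complex.normSq_eq_norm_sq, Complex.normSq_apply]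
  rw [hsq] at h3
  simp [pow_two]
  nlinarith

theorem norm_sub_radial {x : ℂ} (hx : ‖x‖ = 1) {r : ℝ} (hr : r ≤ 1) :
    ‖x - r * x‖ = 1 - r := by
  have : x - r * x = ((1 - r : ℝ) : ℂ) * x := by push_cast; ring
  rw [this, norm_mul, hx, mul_one, Complex.norm_real, Real.norm_of_nonneg (sub_nonneg.2 hr)]

theorem tendsto_radial_stolzRegion {x : ℂ} (hx : ‖x‖ = 1) {R : ℝ} (hR : 1 < R) :
    Tendsto (fun r : ℝ => (r : ℂ) * x) (𝓝[<] 1) (𝓝[stolzRegion x R] x) := by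
  refine tendsto_nhdsWithin_iff.2 ⟨?_, ?_⟩
  · have : Continuous fun r : ℝ => (r : ℂ) * x := by fun_prop
    simpa using (this.tendsto 1).mono_left (nhdsWithin_le_nhds (s := Iio 1))
  · filter_upwards [Ioo_mem_nhdsLT (show (0 : ℝ) < 1 by norm_num)] with r hr
    have hrx : ‖(r : ℂ) * x‖ = r := by
      rw [norm_mul, hx, mul_one, Complex.norm_real, Real.norm_of_nonneg hr.1.le]
    refine ⟨by rw [mem_ball_zero_iff, hrx]; exact hr.2, ?_⟩
    rw [hrx, norm_sub_radial hx hr.2.le]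
    nlinarith [hr.2]

/-- A point of mass at least `C` is a point of radial growth at least `C / (1 - r)`. -/
theorem radial_growth_of_mem_regularPolesOfMass {G : ℂ → ℂ} {x : ℂ} {C D : ℝ} (hC : 0 < C)
    (hD : C ≤ D) (hx : x ∈ regularPolesOfMass G D) :
    ∀ c < C, ∀ᶠ r : ℝ in 𝓝[<] 1, c < (1 - r) * ‖G (r * x)‖ := by
  obtain ⟨hx1, hx2⟩ := hx
  rw [mem_sphere_zero_iff_norm] at hx1
  intro c hc
  have h1 : ENNReal.ofReal c < liminf (fun z => ‖G z * (x - z)‖ₑ) (𝓝[stolzRegion x 2] x) := by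
    calc ENNReal.ofReal c < ENNReal.ofReal D :=
          (ENNReal.ofReal_lt_ofReal_iff (by linarith)).2 (by linarith)
      _ = angularLiminf (fun z => ‖G z * (x - z)‖ₑ) x := hx2.symm
      _ ≤ _ := iInf₂_le 2 (by simp)
  have h2 := (tendsto_radial_stolzRegion hx1 one_lt_two).eventually
    (eventually_lt_of_lt_liminf h1)
  filter_upwards [h2, self_mem_nhdsWithin] with r hr hr1
  rw [← ofReal_norm, ENNReal.ofReal_lt_ofReal_iff', norm_mul,
    norm_sub_radial hx1 (le_of_lt hr1), mul_comm] at hr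
  exact hr.1

theorem corollary3p6 (G : ℂ → ℂ) (hG : IsInfinitesimalGenerator G) (C : ℝ) (hC : 0 < C) :
    (⋃ D ∈ Ici C, regularPolesOfMass G D).Finite := by
  have hGd : DifferentiableOn ℂ G (Metric.ball 0 1) := by
    obtain ⟨φ, -, h, -⟩ := hG
    exact h
  set h : ℂ → ℂ := fun z => -(G z - G 0 + (starRingEnd ℂ) (G 0) * z ^ 2) with hh
  have hhd : DifferentiableOn ℂ h (Metric.ball 0 1) :=
    ((hGd.sub_const _).add (by fun_prop)).neg
  -- Since `h 0 = 0`, this is `h z / z` with the singularity at `0` removed.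
  set p : ℂ → ℂ := dslope h 0 with hpdef
  have hpd : DifferentiableOn ℂ p (Metric.ball 0 1) :=
    (Complex.differentiableOn_dslope (Metric.ball_mem_nhds _ one_pos)).2 hhd
  have hzp : ∀ z, z * p z = h z := by
    intro z
    have h1 := sub_smul_dslope h 0 z
    have h2 : h 0 = 0 := by simp [hh]
    rwa [sub_zero, h2, sub_zero, smul_eq_mul] at h1
  have hp' : ∀ z : ℂ, ‖z‖ < 1 → z ≠ 0 → 0 ≤ (p z).re := by
    intro z hz hz0
    have h1 := hG.re_conj_mul_le hz
    have h2 : (starRingEnd ℂ) z * (G z - G 0 + (starRingEnd ℂ) (G 0) * z ^ 2) =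
        -((‖z‖ ^ 2 : ℝ) * p z) := by
      have h3 : G z - G 0 + (starRingEnd ℂ) (G 0) * z ^ 2 = -(z * p z) := by
        rw [hzp]; simp [hh]
      rw [h3]
      push_cast
      rw [← Complex.conj_mul']
      ring
    rw [h2, Complex.neg_re, Complex.re_ofReal_mul] at h1
    have h4 : 0 < ‖z‖ ^ 2 := by positivity
    exact nonneg_of_mul_nonneg_right (by linarith) h4
  have hp : ∀ z : ℂ, ‖z‖ < 1 → 0 ≤ (p z).re := by
    intro z hz
    rcases eq_or_ne z 0 with rfl | hz0
    · have hc : ContinuousAt p 0 :=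
        (hpd.differentiableAt (Metric.ball_mem_nhds _ one_pos)).continuousAt
      have ht : Tendsto (fun u => (p u).re) (𝓝[≠] 0) (𝓝 (p 0).re) :=
        (Complex.continuous_re.continuousAt.comp hc).tendsto.mono_left nhdsWithin_le_nhds
      refine ge_of_tendsto ht ?_
      filter_upwards [self_mem_nhdsWithin,
        mem_nhdsWithin_of_mem_nhds (Metric.ball_mem_nhds (0 : ℂ) one_pos)] with u hu hu1
      exact hp' u (by simpa using hu1) hu
    · exact hp' z hz hz0
  have hbound : ∀ S : Finset ℂ, (S : Set ℂ) ⊆ (⋃ D ∈ Ici C, regularPolesOfMass G D) →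
      S.card * (C / 2) ≤ (p 0).re := by
    intro S hS
    refine card_mul_le_re_of_radial_growth hC S p hpd hp ?_
    intro x hx
    obtain ⟨D, hD, hxD⟩ := mem_iUnion₂.1 (hS hx)
    have hx1 : ‖x‖ = 1 := by simpa using hxD.1
    refine ⟨hx1, eventually_lt_of_le_add (radial_growth_of_mem_regularPolesOfMass hC hD hxD)
      -- On the disc `‖G w‖` exceeds `‖p w‖` by at most `2 * ‖G 0‖`.
      (e := fun r : ℝ => (1 - r) * (2 * ‖G 0‖)) ?_ ?_⟩
    · have : Continuous fun r : ℝ => (1 - r) * (2 * ‖G 0‖) := by fun_prop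
      simpa using (this.tendsto 1).mono_left (nhdsWithin_le_nhds (s := Iio 1))
    · filter_upwards [Ioo_mem_nhdsLT (show (0 : ℝ) < 1 by norm_num)] with r hr
      have hrx : ‖(r : ℂ) * x‖ = r := by
        rw [norm_mul, hx1, mul_one, Complex.norm_real, Real.norm_of_nonneg hr.1.le]
      rw [← mul_add]
      refine mul_le_mul_of_nonneg_left ?_ (by linarith [hr.2])
      set w : ℂ := r * x
      have h1 : G w = -(w * p w) + (G 0 - (starRingEnd ℂ) (G 0) * w ^ 2) := by
        rw [hzp]; simp only [hh]; ring
      have h2 : ‖w * p w‖ ≤ ‖p w‖ := by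
        rw [norm_mul, hrx]
        exact mul_le_of_le_one_left (norm_nonneg _) hr.2.le
      have h3 : ‖(starRingEnd ℂ) (G 0) * w ^ 2‖ ≤ ‖G 0‖ := by
        rw [norm_mul, RCLike.norm_conj, norm_pow, hrx]
        exact mul_le_of_le_one_right (norm_nonneg _) (by nlinarith [hr.1, hr.2])
      calc ‖G w‖ ≤ ‖-(w * p w)‖ + ‖G 0 - (starRingEnd ℂ) (G 0) * w ^ 2‖ := by
            rw [h1]; exact norm_add_le _ _
        _ ≤ ‖w * p w‖ + (‖G 0‖ + ‖(starRingEnd ℂ) (G 0) * w ^ 2‖) := by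
            rw [norm_neg]; gcongr; exact norm_sub_le _ _
        _ ≤ _ := by linarith
  by_contra hinf
  obtain ⟨n, hn⟩ := exists_nat_gt ((p 0).re / (C / 2))
  obtain ⟨S, hS, hcard⟩ := Set.Infinite.exists_subset_card_eq hinf n
  have := hbound S hS
  rw [hcard, ← le_div_iff₀ (by positivity)] at this
  linarith
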